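/- There are absolute constants $c_1, C_1 > 0$ (independent of the dimension and of all other data) with the following property. Let $d$ be a natural number, let $\mathbb T^d = (\mathbb R/2\pi\mathbb Z)^d$, and let $|\cdot|$ denote the Lebesgue measure on $\mathbb T^d$ normalized so that $|\mathbb T^d| = 1$ (for a non-measurable set, the corresponding outer measure). For a finite set $Q \subset \mathbb Z^d$ with $|Q|$ elements, let $$\mathcal T(Q) = \Bigl\{ f(\mathbf x) = \sum_{\mathbf k \in Q} c_{\mathbf k} e^{i(\mathbf k,\mathbf x)} : c_{\mathbf k} \in \mathbb C \Bigr\}$$ be the space of trigonometric polynomials with frequencies in $Q$. Then for every finite $Q \subset \mathbb Z^d$, every $B \subset \mathbb T^d$ with $|B| \le c_1 |Q|^{-1}$ (no restriction on $B$ if $Q$ is empty), and every $f \in \mathcal T(Q)$, $$\|f\|_{L_\infty(\mathbb T^d)} \le C_1 |Q|^{1/2}\, \|f\|_{L_\infty(\mathbb T^d \setminus B)},$$ where $\|f\|_{L_\infty(\mathbb T^d)} = \max_{\mathbf x \in \mathbb T^d} |f(\mathbf x)|$ is the uniform norm and $\|f\|_{L_\infty(\mathbb T^d\setminus B)}$ is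 the essential supremum of $|f|$ over $\mathbb T^d \setminus B$; since this is at most the supremum of $|f|$ over $\mathbb T^d\setminus B$, the inequality holds with the supremum as well. -/

import Mathlib

open scoped ENNReal

/-- The `d`-dimensional torus `𝕋^d = (ℝ / 2πℤ)^d`. -/
abbrev Torus (d : ℕ) : Type := Fin d → AddCircle (2 * Real.pi)

instance factTwoPiPos : Fact (0 < 2 * Real.pi) := ⟨Real.two_pi_pos⟩

/-- The normalized Lebesgue measure on `𝕋^d` (total mass one): the product of the normalized
Haar measures of the coordinate circles. -/
noncomputable def torusMeasure (d : ℕ) : MeasureTheory.Measure (Torus d) :=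
  MeasureTheory.Measure.pi fun _ => AddCircle.haarAddCircle

/-- The exponential `x ↦ e^{i (k, x)}` with frequency `k ∈ ℤ^d`. -/
noncomputable def torusExp {d : ℕ} (k : Fin d → ℤ) (x : Torus d) : ℂ :=
  ∏ j, fourier (k j) (x j)

/-- `torusExp k` is indeed `e^{i (k, x)}` at the class of a real vector `x`. -/
theorem torusExp_coe {d : ℕ} (k : Fin d → ℤ) (x : Fin d → ℝ) :
    torusExp k (fun j => (x j : AddCircle (2 * Real.pi))) =
      Complex.exp (Complex.I * ∑ j, (k j : ℂ) * (x j : ℂ)) := by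
  unfold torusExp
  rw [Finset.mul_sum, Complex.exp_sum]
  refine Finset.prod_congr rfl fun j _ => ?_
  rw [fourier_coe_apply]
  congr 1
  have : (Real.pi : ℂ) ≠ 0 := by exact_mod_cast Real.pi_ne_zero
  push_cast
  field_simp

/-- The space `𝒯(Q)` of trigonometric polynomials `∑_{k ∈ Q} c_k e^{i (k, x)}`, with complex
coefficients, with frequencies in the finite set `Q ⊂ ℤ^d`, as continuous functions on `𝕋^d`. -/
def trigPoly {d : ℕ} (Q : Finset (Fin d → ℤ)) : Set C(Torus d, ℂ) :=
  {f | ∃ c : (Fin d → ℤ) → ℂ, ∀ x, f x = ∑ k ∈ Q, c k * torusExp k x}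

/-! By Cauchy–Schwarz on the coefficients and Parseval, `‖f‖² ≤ |Q| ∫ |f|²`
(`norm_sq_le_card_mul_integral`). Splitting the integral at a set `A` outside which `|f| ≤ m` gives
`‖f‖² ≤ |Q| (‖f‖² |A| + m²)` (`integral_norm_sq_le`). If `|A| ≤ 1 / (2|Q|)`, the first term is at
most `‖f‖² / 2` and is absorbed on the left. -/

open MeasureTheory in
instance torusMeasure.instIsProbabilityMeasure (d : ℕ) : IsProbabilityMeasure (torusMeasure d) := by
  unfold torusMeasure
  infer_instance

theorem continuous_torusExp {d : ℕ} (k : Fin d → ℤ) : Continuous (torusExp k) := by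
  unfold torusExp
  fun_prop

theorem norm_torusExp {d : ℕ} (k : Fin d → ℤ) (x : Torus d) : ‖torusExp k x‖ = 1 := by
  simp only [torusExp, norm_prod, fourier_apply, Circle.norm_coe, Finset.prod_const_one]

/-- The exponentials are orthonormal with respect to the normalized measure. -/
theorem integral_conj_torusExp_mul {d : ℕ} (k l : Fin d → ℤ) :
    ∫ x, (starRingEnd ℂ) (torusExp k x) * torusExp l x ∂(torusMeasure d) =
      if k = l then 1 else 0 := by
  have h1 (x : Torus d) : (starRingEnd ℂ) (torusExp k x) * torusExp l x =
      ∏ j, (fourier (-k j) (x j) * fourier (l j) (x j)) := by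
    simp only [torusExp, map_prod, ← fourier_neg, Finset.prod_mul_distrib]
  have h2 (j : Fin d) : ∫ t : AddCircle (2 * Real.pi), (fourier (-k j) t * fourier (l j) t : ℂ)
      ∂AddCircle.haarAddCircle = if k j = l j then 1 else 0 := by
    have h := congrFun (fourierCoeff_fourier (T := 2 * Real.pi) (l j)) (k j)
    simpa [fourierCoeff, Pi.single_apply] using h
  simp only [h1]
  unfold torusMeasure
  rw [MeasureTheory.integral_fintype_prod_eq_prod
    (fun j (t : AddCircle (2 * Real.pi)) => (fourier (-k j) t * fourier (l j) t : ℂ))]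
  simp only [h2, Finset.prod_ite_zero, Finset.prod_const_one, Finset.mem_univ, true_imp_iff,
    funext_iff]

/-- Parseval's identity for trigonometric polynomials. -/
theorem integral_norm_sq_eq_sum {d : ℕ} (Q : Finset (Fin d → ℤ)) (c : (Fin d → ℤ) → ℂ) :
    ∫ x, ‖∑ k ∈ Q, c k * torusExp k x‖ ^ 2 ∂(torusMeasure d) = ∑ k ∈ Q, ‖c k‖ ^ 2 := by
  have hexp (x : Torus d) : ((‖∑ k ∈ Q, c k * torusExp k x‖ ^ 2 : ℝ) : ℂ) =
      ∑ k ∈ Q, ∑ l ∈ Q, ((starRingEnd ℂ) (c k) * c l) *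
        ((starRingEnd ℂ) (torusExp k x) * torusExp l x) := by
    rw [Complex.ofReal_pow, ← Complex.conj_mul', map_sum, Finset.sum_mul_sum]
    refine Finset.sum_congr rfl fun k _ => Finset.sum_congr rfl fun l _ => ?_
    rw [map_mul]
    ring
  have hint (k l : Fin d → ℤ) : MeasureTheory.Integrable
      (fun x => ((starRingEnd ℂ) (c k) * c l) *
        ((starRingEnd ℂ) (torusExp k x) * torusExp l x)) (torusMeasure d) := by
    have hk := continuous_torusExp k
    have hl := continuous_torusExp l
    have hc : Continuous fun x => ((starRingEnd ℂ) (c k) * c l) *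
        ((starRingEnd ℂ) (torusExp k x) * torusExp l x) :=
      continuous_const.mul ((Complex.continuous_conj.comp hk).mul hl)
    exact hc.integrable_of_hasCompactSupport (HasCompactSupport.of_compactSpace _)
  apply Complex.ofReal_injective
  rw [← integral_complex_ofReal]
  simp only [hexp]
  rw [MeasureTheory.integral_finsetSum _ fun k _ =>
    MeasureTheory.integrable_finsetSum _ fun l _ => hint k l]
  rw [Complex.ofReal_sum]
  refine Finset.sum_congr rfl fun k hk => ?_
  rw [MeasureTheory.integral_finsetSum _ fun l _ => hint k l]
  simp only [MeasureTheory.integral_const_mul, integral_conj_torusExp_mul, mul_ite, mul_one,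
    mul_zero, Finset.sum_ite_eq, hk, if_true]
  rw [Complex.conj_mul', Complex.ofReal_pow]

/-- The Nikol'skii inequality between the uniform norm and the `L₂` norm on `𝒯(Q)`. -/
theorem norm_sq_le_card_mul_integral {d : ℕ} {Q : Finset (Fin d → ℤ)} {f : C(Torus d, ℂ)}
    (hf : f ∈ trigPoly Q) :
    ‖f‖ ^ 2 ≤ Q.card * ∫ x, ‖f x‖ ^ 2 ∂(torusMeasure d) := by
  obtain ⟨c, hc⟩ := hf
  -- Exponentials have modulus one, so the `ℓ¹` norm of the coefficients bounds `f`; Cauchy–Schwarz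
  -- then costs the factor `|Q|`.
  have hle : ‖f‖ ≤ ∑ k ∈ Q, ‖c k‖ := by
    refine (ContinuousMap.norm_le _ (by positivity)).2 fun x => ?_
    rw [hc x]
    refine (norm_sum_le _ _).trans_eq (Finset.sum_congr rfl fun k _ => ?_)
    rw [norm_mul, norm_torusExp, mul_one]
  simp only [hc, integral_norm_sq_eq_sum]
  exact (pow_le_pow_left₀ (norm_nonneg _) hle 2).trans sq_sum_le_card_mul_sum_sq

/-- Splitting the `L₂` norm over a measurable set and its complement. -/
theorem integral_norm_sq_le {d : ℕ} (f : C(Torus d, ℂ)) {A : Set (Torus d)}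
    (hA : MeasurableSet A) {m : ℝ}
    (hm : ∀ᵐ x ∂(torusMeasure d).restrict Aᶜ, ‖f x‖ ≤ m) :
    ∫ x, ‖f x‖ ^ 2 ∂(torusMeasure d) ≤ ‖f‖ ^ 2 * (torusMeasure d).real A + m ^ 2 := by
  have hint : MeasureTheory.Integrable (fun x => ‖f x‖ ^ 2) (torusMeasure d) :=
    (f.continuous.norm.pow 2).integrable_of_hasCompactSupport
      (HasCompactSupport.of_compactSpace _)
  rw [← MeasureTheory.integral_add_compl hA hint]
  gcongr
  · refine (Real.le_norm_self _).trans
      (MeasureTheory.norm_setIntegral_le_of_norm_le_const (MeasureTheory.measure_lt_top _ _)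
        fun x _ => ?_)
    rw [norm_pow, norm_norm]
    exact pow_le_pow_left₀ (norm_nonneg _) (f.norm_coe_le_norm x) 2
  · have h : ∀ᵐ x ∂(torusMeasure d).restrict Aᶜ, ‖‖f x‖ ^ 2‖ ≤ m ^ 2 := by
      filter_upwards [hm] with x hx
      rw [norm_pow, norm_norm]
      exact pow_le_pow_left₀ (norm_nonneg _) hx 2
    refine (Real.le_norm_self _).trans ((MeasureTheory.norm_integral_le_of_norm_le_const h).trans ?_)
    refine mul_le_of_le_one_right (sq_nonneg m) ?_
    rw [MeasureTheory.measureReal_restrict_apply_univ]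
    exact MeasureTheory.measureReal_le_one

/-- `‖f‖ₑ` is the uniform norm of `f` on the torus, and `eLpNorm f ∞ (μ.restrict Bᶜ)` is the
essential supremum of `|f|` over the complement of `B`, which is at most the supremum of `|f|`
there. For a set `B` that is not measurable, `torusMeasure d B` is its outer measure. -/
theorem theorem5p2 :
    ∃ c₁ C₁ : ℝ, 0 < c₁ ∧ 0 < C₁ ∧
      ∀ (d : ℕ) (Q : Finset (Fin d → ℤ)) (B : Set (Torus d)),
        torusMeasure d B ≤ ENNReal.ofReal c₁ * (Q.card : ℝ≥0∞)⁻¹ →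
        ∀ f ∈ trigPoly Q,
          ‖f‖ₑ ≤ ENNReal.ofReal (C₁ * Real.sqrt (Q.card : ℝ)) *
            MeasureTheory.eLpNorm f ∞ ((torusMeasure d).restrict Bᶜ) := by
  -- Absorption with `c₁ = 1/2` leaves `‖f‖² ≤ 2|Q| m²`, so `√2` would do for `C₁`; `2` avoids the
  -- root.
  refine ⟨1 / 2, 2, by norm_num, by norm_num, fun d Q B hB f hf => ?_⟩
  -- For empty `Q` the bound on `B` is vacuous, as `0⁻¹ = ∞`, but `f = 0`.
  obtain rfl | hQ := Q.eq_empty_or_nonempty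
  · obtain ⟨c, hc⟩ := hf
    have hf0 : f = 0 := ContinuousMap.ext fun x => by simpa using hc x
    simp [hf0]
  have hcard : (0 : ℝ) < Q.card := by exact_mod_cast hQ.card_pos
  set M := MeasureTheory.eLpNorm f ∞ ((torusMeasure d).restrict Bᶜ) with hM
  by_cases hMtop : M = ∞
  · have hpos : ENNReal.ofReal (2 * Real.sqrt (Q.card : ℝ)) ≠ 0 := by
      rw [Ne, ENNReal.ofReal_eq_zero, not_le]
      positivity
    rw [hMtop, ENNReal.mul_top hpos]
    exact le_top
  -- The measurable hull has the outer measure of `B`, and its complement lies in `Bᶜ`, so the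
  -- essential bound `M` persists there.
  set A := MeasureTheory.toMeasurable (torusMeasure d) B with hAdef
  have hA : MeasurableSet A := MeasureTheory.measurableSet_toMeasurable _ _
  have hsub : Aᶜ ⊆ Bᶜ := Set.compl_subset_compl.2 (MeasureTheory.subset_toMeasurable _ _)
  have hm : ∀ᵐ x ∂(torusMeasure d).restrict Aᶜ, ‖f x‖ ≤ M.toReal := by
    have h : ∀ᵐ x ∂(torusMeasure d).restrict Bᶜ, ‖f x‖ₑ ≤ M := by
      rw [hM, MeasureTheory.eLpNorm_exponent_top]
      exact MeasureTheory.ae_le_eLpNormEssSup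
    filter_upwards [MeasureTheory.ae_restrict_of_ae_restrict_of_subset hsub h] with x hx
    simpa using ENNReal.toReal_mono hMtop hx
  have hAreal : (torusMeasure d).real A ≤ 1 / 2 / Q.card := by
    have h : torusMeasure d A ≤ ENNReal.ofReal (1 / 2 / Q.card) := by
      rw [hAdef, MeasureTheory.measure_toMeasurable, ENNReal.ofReal_div_of_pos hcard,
        ENNReal.ofReal_natCast, div_eq_mul_inv]
      exact hB
    exact ENNReal.toReal_le_of_le_ofReal (by positivity) h
  have hkey : ‖f‖ ^ 2 ≤ (2 * Real.sqrt Q.card * M.toReal) ^ 2 := by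
    have h1 := (norm_sq_le_card_mul_integral hf).trans
      (mul_le_mul_of_nonneg_left (integral_norm_sq_le f hA hm) hcard.le)
    have h2 : ‖f‖ ^ 2 * (torusMeasure d).real A * Q.card ≤ ‖f‖ ^ 2 * (1 / 2) := by
      rw [mul_assoc]
      gcongr
      exact (le_div_iff₀ hcard).1 hAreal
    rw [mul_pow, mul_pow, Real.sq_sqrt hcard.le]
    nlinarith [mul_nonneg hcard.le (sq_nonneg M.toReal)]
  have hle : ‖f‖ ≤ 2 * Real.sqrt Q.card * M.toReal := le_of_sq_le_sq hkey (by positivity)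
  rw [← ofReal_norm, ← ENNReal.ofReal_toReal hMtop, ← ENNReal.ofReal_mul (by positivity)]
  exact ENNReal.ofReal_le_ofReal hle
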